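/- **Lemma (perturbation bound on the representation).** Let $1\le Z<M$. Consider data $x_n\in\mathbb R^D$ ($n\le N$) with pairs $x_{n,q}\in\mathbb R^D$ ($q\le Q$), $\|x_n\|_\infty,\|x_{n,q}\|_\infty\le c_{in}$, signs $\alpha_q\in\{1,-1\}$, a constant $\delta>0$, $\delta'=\sqrt M\,\delta$, and an entrywise activation $\phi:\mathbb R\to\mathbb R$ that is $L_\phi$-Lipschitz and differentiable with $\beta_\phi$-Lipschitz derivative. Norms of vectors are Euclidean unless marked. For $V\in\mathbb R^{M\times D}$ and $W\in\mathbb R^{M\times Z}$ put $$s_{W,V}(x,y)=\frac{(W^\top\phi(Vx))^\top(W^\top\phi(Vy))}{(\|\phi(Vx)\|+\delta')(\|\phi(Vy)\|+\delta')},\qquad \mathcal L(W,V)=-\frac1N\sum_{n,q}\alpha_q\,s_{W,V}(x_n,x_{n,q}),$$ $$C_V=\frac1N\sum_{n,q}\frac{\alpha_q\,\phi(Vx_{n,q})\phi(Vx_n)^\top}{(\|\phi(Vx_{n,q})\|+\delta')(\|\phi(Vx_n)\|+\delta')},\qquad \widetilde C_V=\tfrac12(C_V+C_V^\top).$$ Let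 $(W(t),V(t))_{t\in\mathbb N}$ be obtained from weights with $W(0)^\top W(0)=\mathbb I_Z$ and all entries of $W(0),V(0)$ at most $c_\theta\log M$ in absolute value by training on $\mathcal L$ with learning rate $\eta>0$: gradient descent $V(t+1)=V(t)-\eta\,\partial_V\mathcal L(W(t),V(t))$, and Grassmannian gradient descent for $W$, i.e. $W(t+1)$ is the image under a retraction at $W(t)$ (for example, the geodesic one), which preserves $W^\top W=\mathbb I_Z$, of the step $-\eta\,(\mathbb I-W(t)W(t)^\top)\,\partial_W\mathcal L(W(t),V(t))$. Write $\widetilde C_V(t)=\widetilde C_{V(t)}$. Let $\lambda_Z>\lambda_{Z+1}$ be the $Z$-th and $(Z+1)$-th largest eigenvalues of $\widetilde C_V(0)$, and let $W^*$ and $\widetilde W^*$ be PCA solutions for $\widetilde C_V(0)$ and $\widetilde C_V(t)$, that is, maximisers of $\mathrm{Tr}(W^\top CW)$ subject to $W^\top W=\mathbb I_Z$ for $C=\widetilde C_V(0)$ and $C=\widetilde C_V(t)$ respectively. For an input $x$ let $u(x;W^*,\widetilde C_V(0))=\frac1{\sqrt M}W^{*\top}\phi(V(0)x)$ and $u(x;\widetilde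 W^*,\widetilde C_V(t))=\frac1{\sqrt M}\widetilde W^{*\top}\phi(V(t)x)$. Assume that the network is wide in the sense that $D\le 16M$ and, if $\phi(0)\ne0$, also $8\,c_{in}\sqrt{MD}\,\log M\ge1$. (When $D\ge 1$ and $c_{in}>0$, both hold for all sufficiently large $M$.) Then, with $$\zeta=4\delta^{-1}\eta Q\sqrt D\,L_\phi^2c_{in}^2,\qquad \xi=2^{7/2}\delta^{-1}QDc_{in}\bigl(L_\phi c_\theta+|\phi(0)|\bigr),$$ for every $t\in\mathbb N$ there is an orthogonal matrix $O\in\mathbb R^{Z\times Z}$ such that for every input $x$ with $\|x\|_\infty\le c_{in}$ $$\bigl\|O^\top u(x;\widetilde W^*,\widetilde C_V(t))-u(x;W^*,\widetilde C_V(0))\bigr\|\le\zeta\,\frac{t}{\sqrt M}\left(1+\frac{\xi\log M}{\lambda_Z-\lambda_{Z+1}}\right).$$ -/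

import Mathlib

open scoped Matrix

namespace ContrastivePCA

noncomputable section

/-- Euclidean norm of a vector of reals (the norm on `Fin k → ℝ` itself is the sup norm). -/
def euclNorm {k : ℕ} (v : Fin k → ℝ) : ℝ := ‖WithLp.toLp 2 v‖

/-- Hidden-layer features `φ(V x)`, with `φ` acting entrywise. -/
def feature {D M : ℕ} (φ : ℝ → ℝ) (V : Matrix (Fin M) (Fin D) ℝ) (x : Fin D → ℝ) :
    Fin M → ℝ :=
  fun i => φ ((V *ᵥ x) i)

/-- Representation `M^{-1/2} Wᵀ φ(V x)` of the two-layer network. -/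
def representation {D M Z : ℕ} (φ : ℝ → ℝ) (W : Matrix (Fin M) (Fin Z) ℝ)
    (V : Matrix (Fin M) (Fin D) ℝ) (x : Fin D → ℝ) : Fin Z → ℝ :=
  (1 / Real.sqrt M) • (Wᵀ *ᵥ feature φ V x)

/-- The normaliser `‖φ(V x)‖ + δ'` with `δ' = √M δ`. -/
def normaliser {D M : ℕ} (φ : ℝ → ℝ) (δ : ℝ) (V : Matrix (Fin M) (Fin D) ℝ)
    (x : Fin D → ℝ) : ℝ :=
  euclNorm (feature φ V x) + Real.sqrt M * δ

/-- The modified cosine similarity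
`(Wᵀφ(Vx))ᵀ(Wᵀφ(Vy)) / ((‖φ(Vx)‖ + δ')(‖φ(Vy)‖ + δ'))`. -/
def similarity {D M Z : ℕ} (φ : ℝ → ℝ) (δ : ℝ) (W : Matrix (Fin M) (Fin Z) ℝ)
    (V : Matrix (Fin M) (Fin D) ℝ) (x y : Fin D → ℝ) : ℝ :=
  ((Wᵀ *ᵥ feature φ V x) ⬝ᵥ (Wᵀ *ᵥ feature φ V y)) /
    (normaliser φ δ V x * normaliser φ δ V y)

/-- The linear contrastive loss `-(1/N) ∑ₙ ∑_q α_q s(xₙ, x_{n,q})`. -/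
def loss {D M Z N Q : ℕ} (φ : ℝ → ℝ) (δ : ℝ) (α : Fin Q → ℝ)
    (x : Fin N → Fin D → ℝ) (xp : Fin N → Fin Q → Fin D → ℝ)
    (W : Matrix (Fin M) (Fin Z) ℝ) (V : Matrix (Fin M) (Fin D) ℝ) : ℝ :=
  -((1 / (N : ℝ)) * ∑ n, ∑ q, α q * similarity φ δ W V (x n) (xp n q))

/-- The matrix `C_V`. -/
def contrastMatrix {D M N Q : ℕ} (φ : ℝ → ℝ) (δ : ℝ) (α : Fin Q → ℝ)
    (x : Fin N → Fin D → ℝ) (xp : Fin N → Fin Q → Fin D → ℝ)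
    (V : Matrix (Fin M) (Fin D) ℝ) : Matrix (Fin M) (Fin M) ℝ :=
  (1 / (N : ℝ)) • ∑ n, ∑ q,
    (α q / (normaliser φ δ V (xp n q) * normaliser φ δ V (x n))) •
      Matrix.vecMulVec (feature φ V (xp n q)) (feature φ V (x n))

/-- The symmetrised matrix `C̃_V = (C_V + C_Vᵀ) / 2`. -/
def symContrastMatrix {D M N Q : ℕ} (φ : ℝ → ℝ) (δ : ℝ) (α : Fin Q → ℝ)
    (x : Fin N → Fin D → ℝ) (xp : Fin N → Fin Q → Fin D → ℝ)
    (V : Matrix (Fin M) (Fin D) ℝ) : Matrix (Fin M) (Fin M) ℝ :=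
  (1 / 2 : ℝ) • (contrastMatrix φ δ α x xp V + (contrastMatrix φ δ α x xp V)ᵀ)

theorem symContrastMatrix_isHermitian {D M N Q : ℕ} (φ : ℝ → ℝ) (δ : ℝ) (α : Fin Q → ℝ)
    (x : Fin N → Fin D → ℝ) (xp : Fin N → Fin Q → Fin D → ℝ)
    (V : Matrix (Fin M) (Fin D) ℝ) :
    (symContrastMatrix φ δ α x xp V).IsHermitian := by
  unfold symContrastMatrix Matrix.IsHermitian
  rw [Matrix.conjTranspose_eq_transpose_of_trivial, Matrix.transpose_smul,
    Matrix.transpose_add, Matrix.transpose_transpose, add_comm]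

/-- The matrix of partial derivatives `∂F/∂A_{ij}`. -/
def matrixGrad {m n : ℕ} (F : Matrix (Fin m) (Fin n) ℝ → ℝ) (A : Matrix (Fin m) (Fin n) ℝ) :
    Matrix (Fin m) (Fin n) ℝ :=
  Matrix.of fun i j => deriv (fun s : ℝ => F (A + s • Matrix.single i j (1 : ℝ))) 0

/-- `R` is a retraction for Grassmannian gradient steps: from a matrix `W` with orthonormal
columns and a horizontal tangent vector `H` (that is, `WᵀH = 0`) it produces a matrix with
orthonormal columns, and `s ↦ R W (sH)` leaves `W` with velocity `H`. The Grassmann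
geodesic `R W H = exp(HWᵀ - WHᵀ) W` and the QR and polar retractions are examples. -/
structure IsGrassmannRetraction {M Z : ℕ}
    (R : Matrix (Fin M) (Fin Z) ℝ → Matrix (Fin M) (Fin Z) ℝ → Matrix (Fin M) (Fin Z) ℝ) :
    Prop where
  orthonormal : ∀ W H : Matrix (Fin M) (Fin Z) ℝ, Wᵀ * W = 1 → Wᵀ * H = 0 → (R W H)ᵀ * R W H = 1
  map_zero : ∀ W : Matrix (Fin M) (Fin Z) ℝ, Wᵀ * W = 1 → R W 0 = W
  velocity : ∀ W H : Matrix (Fin M) (Fin Z) ℝ, Wᵀ * W = 1 → Wᵀ * H = 0 →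
    ∀ i j, HasDerivAt (fun s : ℝ => R W (s • H) i j) (H i j) 0

/-- `(W t, V t)`, `t = 0, 1, 2, …`, are the weights of the network with orthonormality
constraint `WᵀW = 1` trained on the loss with learning rate `η`: gradient descent on `V`,
and Grassmannian gradient descent on `W`, whose search direction is the Euclidean gradient
multiplied on the left by `1 - WWᵀ`. -/
structure IsTrainingRun {D M Z N Q : ℕ} (φ : ℝ → ℝ) (δ η : ℝ) (α : Fin Q → ℝ)
    (x : Fin N → Fin D → ℝ) (xp : Fin N → Fin Q → Fin D → ℝ)
    (R : Matrix (Fin M) (Fin Z) ℝ → Matrix (Fin M) (Fin Z) ℝ → Matrix (Fin M) (Fin Z) ℝ)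
    (W : ℕ → Matrix (Fin M) (Fin Z) ℝ) (V : ℕ → Matrix (Fin M) (Fin D) ℝ) : Prop where
  init : (W 0)ᵀ * W 0 = 1
  step_V : ∀ t, V (t + 1) = V t - η • matrixGrad (fun V' => loss φ δ α x xp (W t) V') (V t)
  step_W : ∀ t, W (t + 1) = R (W t) (-(η • ((1 - W t * (W t)ᵀ) *
    matrixGrad (fun W' => loss φ δ α x xp W' (V t)) (W t))))

/-- `W` solves the PCA problem for the matrix `C`: it maximises `Tr(WᵀCW)` subject to
`WᵀW = 1`. -/
def IsPCASolution {M Z : ℕ} (C : Matrix (Fin M) (Fin M) ℝ) (W : Matrix (Fin M) (Fin Z) ℝ) :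
    Prop :=
  Wᵀ * W = 1 ∧
    ∀ U : Matrix (Fin M) (Fin Z) ℝ, Uᵀ * U = 1 → (Uᵀ * C * U).trace ≤ (Wᵀ * C * W).trace

/-- Eigenvalues of a symmetric matrix in decreasing order, repeated with multiplicity; the
index starts at `0`. -/
def sortedEigenvalue {M : ℕ} {A : Matrix (Fin M) (Fin M) ℝ} (hA : A.IsHermitian)
    (k : Fin M) : ℝ :=
  hA.eigenvalues₀ (Fin.cast (Fintype.card_fin M).symm k)

/-- The `k`-th largest eigenvalue (`k = 1, …, M`) of `C̃_V`. -/
def contrastEigenvalue {D M N Q : ℕ} (φ : ℝ → ℝ) (δ : ℝ) (α : Fin Q → ℝ)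
    (x : Fin N → Fin D → ℝ) (xp : Fin N → Fin Q → Fin D → ℝ)
    (V : Matrix (Fin M) (Fin D) ℝ) (k : ℕ) (h1 : 1 ≤ k) (h2 : k ≤ M) : ℝ :=
  sortedEigenvalue (symContrastMatrix_isHermitian φ δ α x xp V)
    ⟨k - 1, lt_of_lt_of_le (Nat.sub_lt h1 Nat.one_pos) h2⟩

/-- `ζ = 4 δ⁻¹ η Q √D L_φ² c_in²`. -/
def zeta (D Q : ℕ) (δ η Lφ cin : ℝ) : ℝ :=
  4 * δ⁻¹ * η * Q * Real.sqrt D * Lφ ^ 2 * cin ^ 2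

/-- `ξ = 2^{7/2} δ⁻¹ Q D c_in (L_φ c_θ + |φ(0)|)`. -/
def xi (D Q : ℕ) (φ : ℝ → ℝ) (δ Lφ cin cθ : ℝ) : ℝ :=
  (2 : ℝ) ^ (7 / 2 : ℝ) * δ⁻¹ * Q * D * cin * (Lφ * cθ + |φ 0|)

end

end ContrastivePCA

/-! Everything is measured in the Frobenius norm. Since `W t` stays orthonormal, the loss as a
function of `V` has a Lipschitz constant `K = Q Lφ √D cin / (√M δ)` that does not depend on `W t`.
Its gradient is therefore bounded by `K`, and `t` steps move `V` by at most `t η K`. The matrix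
`symContrastMatrix` has the same Lipschitz constant, so it moves by at most `t η K²`.

Both constants come from `norm_bilin_softNormalize_sub_le`: the similarity and the outer product are
contractive bilinear forms in the vectors `v / (‖v‖ + √M δ)`.

A Davis–Kahan argument (`gap_mul_norm_proj_sub_proj_le`) bounds the distance of the two PCA
projections by `2 t η K² / g`, with `g` the eigengap at initialisation only.
`exists_orthogonal_norm_mul_sub_le` turns this into an orthogonal `O` aligning the frames. It is
chosen from the frames alone, hence uniform in the input. The representation then changes by the
feature displacement plus the frame displacement times the initial feature norm.
`perturbation_constant_le` compares the result with `ζ` and `ξ`, using the width assumptions. -/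

namespace ContrastivePCA

/-! ### Soft normalisation `v / (‖v‖ + δ)`: Lipschitz bounds and differentiability. -/

section SoftNormalize

variable {E F : Type*} [NormedAddCommGroup E] [InnerProductSpace ℝ E]
  [NormedAddCommGroup F] [NormedSpace ℝ F]

/-- The map `v ↦ v / (‖v‖ + δ)`. -/
noncomputable def softNormalize (δ : ℝ) (v : E) : E := (‖v‖ + δ)⁻¹ • v

theorem norm_softNormalize {δ : ℝ} (hδ : 0 < δ) (v : E) :
    ‖softNormalize δ v‖ = 1 - δ * (‖v‖ + δ)⁻¹ := by
  have h : 0 < ‖v‖ + δ := by positivity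
  rw [softNormalize, norm_smul, norm_inv, Real.norm_of_nonneg h.le]
  field_simp
  ring

/-- The inner product `⟪v, w⟫` enters both sides with the same coefficient, so only an inequality
between the norms remains, and the difference of its sides factors as a nonnegative product. -/
theorem norm_softNormalize_sub_sq_le {δ : ℝ} (hδ : 0 < δ) (v w : E) :
    ‖softNormalize δ v - softNormalize δ w‖ ^ 2 ≤
      (‖v‖ + δ)⁻¹ * (‖w‖ + δ)⁻¹ * ‖v - w‖ ^ 2 := by
  have ha : 0 < ‖v‖ + δ := by positivity
  have hb : 0 < ‖w‖ + δ := by positivity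
  have key : (‖v‖ + δ)⁻¹ * (‖w‖ + δ)⁻¹ * (‖v‖ ^ 2 + ‖w‖ ^ 2)
      - ((‖v‖ + δ)⁻¹ * ‖v‖) ^ 2 - ((‖w‖ + δ)⁻¹ * ‖w‖) ^ 2
      = ((‖v‖ + δ)⁻¹) ^ 2 * ((‖w‖ + δ)⁻¹) ^ 2 * (‖v‖ - ‖w‖) ^ 2 *
        (‖v‖ * ‖w‖ + δ * (‖v‖ + ‖w‖)) := by
    field_simp
    ring
  have hnn : 0 ≤ ((‖v‖ + δ)⁻¹) ^ 2 * ((‖w‖ + δ)⁻¹) ^ 2 * (‖v‖ - ‖w‖) ^ 2 *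
        (‖v‖ * ‖w‖ + δ * (‖v‖ + ‖w‖)) := by positivity
  rw [norm_sub_sq_real, norm_sub_sq_real, softNormalize, softNormalize, norm_smul, norm_smul,
    real_inner_smul_left, real_inner_smul_right, norm_inv, norm_inv,
    Real.norm_of_nonneg ha.le, Real.norm_of_nonneg hb.le]
  linarith

theorem norm_softNormalize_sub_le {δ : ℝ} (hδ : 0 < δ) (v w : E) :
    ‖softNormalize δ v - softNormalize δ w‖ ≤
      √((‖v‖ + δ)⁻¹ * (‖w‖ + δ)⁻¹) * ‖v - w‖ := by
  refine (sq_le_sq₀ (norm_nonneg _) (by positivity)).1 ?_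
  rw [mul_pow, Real.sq_sqrt (by positivity)]
  exact norm_softNormalize_sub_sq_le hδ v w

/-- The deficit from 2 is governed by the same geometric mean as the Lipschitz factor in
`norm_softNormalize_sub_le`: where the map is steep, its values are short. This trade-off avoids a
factor 2 in the bilinear estimate. -/
theorem norm_softNormalize_add_le {δ : ℝ} (hδ : 0 < δ) (v w : E) :
    ‖softNormalize δ v + softNormalize δ w‖ ≤
      2 - 2 * δ * √((‖v‖ + δ)⁻¹ * (‖w‖ + δ)⁻¹) := by
  have ha : 0 ≤ (‖v‖ + δ)⁻¹ := by positivity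
  have hb : 0 ≤ (‖w‖ + δ)⁻¹ := by positivity
  have h := norm_add_le (softNormalize δ v) (softNormalize δ w)
  rw [norm_softNormalize hδ, norm_softNormalize hδ] at h
  have amgm : 2 * √((‖v‖ + δ)⁻¹ * (‖w‖ + δ)⁻¹) ≤ (‖v‖ + δ)⁻¹ + (‖w‖ + δ)⁻¹ := by
    rw [Real.sqrt_mul ha]
    nlinarith [sq_nonneg (√(‖v‖ + δ)⁻¹ - √(‖w‖ + δ)⁻¹), Real.sq_sqrt ha, Real.sq_sqrt hb]
  nlinarith

theorem mul_sqrt_inv_mul_inv_le_one {δ : ℝ} (hδ : 0 < δ) {a b : ℝ} (ha : 0 ≤ a) (hb : 0 ≤ b) :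
    δ * √((a + δ)⁻¹ * (b + δ)⁻¹) ≤ 1 := by
  have h : √((a + δ)⁻¹ * (b + δ)⁻¹) ≤ δ⁻¹ := by
    refine Real.sqrt_le_iff.2 ⟨by positivity, ?_⟩
    rw [sq]
    gcongr <;> linarith
  calc _ ≤ δ * δ⁻¹ := by gcongr
    _ = 1 := mul_inv_cancel₀ hδ.ne'

/-- A contractive bilinear form of two softly normalised vectors is `δ⁻¹`-Lipschitz for the
maximum of the two displacements. -/
theorem norm_bilin_softNormalize_sub_le {δ d : ℝ} (hδ : 0 < δ) (B : E →ₗ[ℝ] E →ₗ[ℝ] F)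
    (hB : ∀ x y, ‖B x y‖ ≤ ‖x‖ * ‖y‖) {u v u₀ v₀ : E}
    (hu : ‖u - u₀‖ ≤ d) (hv : ‖v - v₀‖ ≤ d) :
    ‖B (softNormalize δ u) (softNormalize δ v) - B (softNormalize δ u₀) (softNormalize δ v₀)‖ ≤
      δ⁻¹ * d := by
  have hd : 0 ≤ d := (norm_nonneg _).trans hu
  -- Symmetric product rule: each difference is paired with a sum, so that both preceding bounds
  -- apply.
  have e : (2 : ℝ) • (B (softNormalize δ u) (softNormalize δ v)
      - B (softNormalize δ u₀) (softNormalize δ v₀)) =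
      B (softNormalize δ u - softNormalize δ u₀) (softNormalize δ v + softNormalize δ v₀) +
      B (softNormalize δ u + softNormalize δ u₀) (softNormalize δ v - softNormalize δ v₀) := by
    simp only [map_add, map_sub, LinearMap.add_apply, LinearMap.sub_apply, two_smul]
    abel
  have hr := mul_sqrt_inv_mul_inv_le_one hδ (norm_nonneg u) (norm_nonneg u₀)
  have hs := mul_sqrt_inv_mul_inv_le_one hδ (norm_nonneg v) (norm_nonneg v₀)
  have h1 := norm_softNormalize_sub_le hδ u u₀
  have h2 := norm_softNormalize_sub_le hδ v v₀
  have h3 := norm_softNormalize_add_le hδ u u₀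
  have h4 := norm_softNormalize_add_le hδ v v₀
  have hr0 := Real.sqrt_nonneg ((‖u‖ + δ)⁻¹ * (‖u₀‖ + δ)⁻¹)
  have hs0 := Real.sqrt_nonneg ((‖v‖ + δ)⁻¹ * (‖v₀‖ + δ)⁻¹)
  set r := √((‖u‖ + δ)⁻¹ * (‖u₀‖ + δ)⁻¹)
  set s := √((‖v‖ + δ)⁻¹ * (‖v₀‖ + δ)⁻¹)
  have h1' := h1.trans (mul_le_mul_of_nonneg_left hu hr0)
  have h2' := h2.trans (mul_le_mul_of_nonneg_left hv hs0)
  have hsum : 2 * ‖B (softNormalize δ u) (softNormalize δ v)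
      - B (softNormalize δ u₀) (softNormalize δ v₀)‖ ≤
      r * d * (2 - 2 * δ * s) + (2 - 2 * δ * r) * (s * d) := by
    calc _ = ‖(2 : ℝ) • (B (softNormalize δ u) (softNormalize δ v)
          - B (softNormalize δ u₀) (softNormalize δ v₀))‖ := by
          rw [norm_smul, Real.norm_ofNat]
      _ ≤ _ := by
        rw [e]
        refine (norm_add_le _ _).trans (add_le_add ((hB _ _).trans ?_) ((hB _ _).trans ?_))
        · exact mul_le_mul h1' h4 (norm_nonneg _) (by positivity)
        · exact mul_le_mul h3 h2' (norm_nonneg _) (by linarith)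
  -- With `a = δr` and `b = δs` in `[0, 1]`, this is `a + b - 2ab ≤ 1`, that is, `(1 - a)(1 - b) +
  -- ab ≥ 0`.
  have hle : r + s - 2 * δ * r * s ≤ δ⁻¹ := by
    rw [← one_div, le_div_iff₀ hδ]
    nlinarith [mul_nonneg (sub_nonneg.2 hr) (sub_nonneg.2 hs),
      mul_nonneg (mul_nonneg hδ.le hr0) (mul_nonneg hδ.le hs0)]
  nlinarith

theorem differentiable_softNormalize {δ : ℝ} (hδ : 0 < δ) :
    Differentiable ℝ (softNormalize δ : E → E) := by
  intro v
  by_cases hv : v = 0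
  · subst hv
    -- The norm is not differentiable at 0, but the scalar factor is continuous there with value
    -- `δ⁻¹`, and it multiplies a vector vanishing to first order.
    have h : HasFDerivAt (softNormalize δ : E → E) (δ⁻¹ • ContinuousLinearMap.id ℝ E) 0 := by
      have hc : ContinuousAt (fun w : E => (‖w‖ + δ)⁻¹) 0 := by
        refine ContinuousAt.inv₀ (by fun_prop) (by simpa using hδ.ne')
      rw [hasFDerivAt_iff_isLittleO_nhds_zero]
      have h0 : (fun w : E => (‖w‖ + δ)⁻¹ - δ⁻¹) =o[nhds 0] (fun _ => (1 : ℝ)) := by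
        rw [Asymptotics.isLittleO_one_iff]
        have := hc.sub (continuousAt_const (y := δ⁻¹))
        simpa [ContinuousAt, Pi.sub_def] using this
      have h1 := h0.smul_isBigO (Asymptotics.isBigO_refl (fun w : E => w) (nhds 0))
      simpa [softNormalize, sub_smul] using h1
    exact h.differentiableAt
  · have hn : DifferentiableAt ℝ (fun w : E => ‖w‖) v := 
      (contDiffAt_norm ℝ hv (n := 1)).differentiableAt one_ne_zero
    have : (‖v‖ + δ) ≠ 0 := by positivity
    exact DifferentiableAt.smul ((hn.add_const δ).inv this) differentiableAt_id

end SoftNormalize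

/-! ### Frobenius norm and gradient bounds. -/

section Frobenius

open scoped Matrix.Norms.Frobenius

theorem frobenius_norm_sq {m n : ℕ} (A : Matrix (Fin m) (Fin n) ℝ) :
    ‖A‖ ^ 2 = ∑ i, ∑ j, A i j ^ 2 := by
  rw [Matrix.frobenius_norm_def, ← Real.sqrt_eq_rpow, Real.sq_sqrt (by positivity)]
  simp

theorem norm_toLp_mulVec_le {m n : ℕ} (A : Matrix (Fin m) (Fin n) ℝ) (v : Fin n → ℝ) :
    ‖WithLp.toLp 2 (A *ᵥ v)‖ ≤ ‖A‖ * ‖WithLp.toLp 2 v‖ := by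
  have h := Matrix.frobenius_norm_mul A (Matrix.replicateCol Unit v)
  rwa [← Matrix.replicateCol_mulVec, Matrix.frobenius_norm_replicateCol,
    Matrix.frobenius_norm_replicateCol] at h

theorem norm_vecMulVec_le {m n : ℕ} (u : Fin m → ℝ) (v : Fin n → ℝ) :
    ‖Matrix.vecMulVec u v‖ ≤ ‖WithLp.toLp 2 u‖ * ‖WithLp.toLp 2 v‖ := by
  rw [Matrix.vecMulVec_eq Unit]
  refine (Matrix.frobenius_norm_mul _ _).trans ?_
  rw [Matrix.frobenius_norm_replicateCol, Matrix.frobenius_norm_replicateRow]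

theorem norm_toLp_le_sqrt_mul {n : ℕ} {v : Fin n → ℝ} {c : ℝ} (hv : ∀ i, |v i| ≤ c) (hc : 0 ≤ c) :
    ‖WithLp.toLp 2 v‖ ≤ √n * c := by
  refine (sq_le_sq₀ (norm_nonneg _) (by positivity)).1 ?_
  rw [EuclideanSpace.norm_sq_eq, mul_pow, Real.sq_sqrt (by positivity)]
  calc ∑ i, ‖v i‖ ^ 2 ≤ ∑ _i : Fin n, c ^ 2 := by
        gcongr with i
        exact hv i
    _ = n * c ^ 2 := by simp

/-- The matrix of partial derivatives of a `K`-Lipschitz function has Frobenius norm at most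
`K` at each point of differentiability. -/
theorem norm_matrixGrad_le {m n : ℕ} {F : Matrix (Fin m) (Fin n) ℝ → ℝ}
    {A : Matrix (Fin m) (Fin n) ℝ} {K : ℝ} (hK : 0 ≤ K)
    (hF : DifferentiableAt ℝ (fun B : Fin m → Fin n → ℝ => F (Matrix.of B)) (Matrix.of.symm A))
    (hlip : ∀ B, |F B - F A| ≤ K * ‖B - A‖) : ‖matrixGrad F A‖ ≤ K := by
  obtain ⟨F', hF'⟩ := hF
  have hline : ∀ G : Matrix (Fin m) (Fin n) ℝ,
      HasDerivAt (fun s : ℝ => F (A + s • G)) (F' (Matrix.of.symm G)) 0 := fun G =>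
    hF'.hasLineDerivAt (Matrix.of.symm G)
  have hentry : ∀ i j, matrixGrad F A i j = F' (Matrix.of.symm (Matrix.single i j 1)) :=
    fun i j => (hline (Matrix.single i j 1)).deriv
  -- The direction is the gradient itself: its directional derivative is `‖∇F‖²`, which the
  -- Lipschitz bound keeps below `K‖∇F‖`.
  have hdir : F' (Matrix.of.symm (matrixGrad F A)) = ‖matrixGrad F A‖ ^ 2 := by
    have hsum : Matrix.of.symm (matrixGrad F A) = ∑ i, ∑ j,
        matrixGrad F A i j • Matrix.of.symm (Matrix.single i j (1 : ℝ)) := by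
      ext k l
      have hs : ∀ i j, Matrix.of.symm (Matrix.single i j (1 : ℝ)) k l
          = if i = k ∧ j = l then 1 else 0 := fun i j => Matrix.single_apply ..
      simp only [Finset.sum_apply, Pi.smul_apply, hs]
      simp [ite_and]
    rw [hsum, frobenius_norm_sq]
    simp only [map_sum, map_smul, ← hentry, smul_eq_mul, sq]
  have h : ‖F' (Matrix.of.symm (matrixGrad F A))‖ ≤ K * ‖matrixGrad F A‖ := by
    refine (hline (matrixGrad F A)).le_of_lip' (by positivity)
      (Filter.Eventually.of_forall fun s => ?_)
    have := hlip (A + s • matrixGrad F A)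
    rw [add_sub_cancel_left, norm_smul] at this
    simp only [zero_smul, add_zero, sub_zero, Real.norm_eq_abs] at this ⊢
    linarith
  rw [hdir, Real.norm_of_nonneg (by positivity), sq] at h
  by_contra! hlt
  have : 0 < ‖matrixGrad F A‖ := hK.trans_lt hlt
  nlinarith

end Frobenius

/-! ### Orthonormal frames, projections and alignment. -/

section Orthonormal

open scoped Matrix.Norms.Frobenius

theorem trace_transpose_mul_le {m n : ℕ} (X Y : Matrix (Fin m) (Fin n) ℝ) :
    (Xᵀ * Y).trace ≤ ‖X‖ * ‖Y‖ := by
  have e : (Xᵀ * Y).trace = ∑ p : Fin n × Fin m, X p.2 p.1 * Y p.2 p.1 := by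
    simp [Matrix.trace, Matrix.mul_apply, Fintype.sum_prod_type]
  have hn : ∀ A : Matrix (Fin m) (Fin n) ℝ, ∑ p : Fin n × Fin m, A p.2 p.1 ^ 2 = ‖A‖ ^ 2 := by
    intro A
    rw [frobenius_norm_sq, Finset.sum_comm, Fintype.sum_prod_type]
  refine (le_abs_self _).trans (abs_le_of_sq_le_sq ?_ (by positivity))
  rw [e, mul_pow, ← hn, ← hn]
  exact Finset.sum_mul_sq_le_sq_mul_sq _ _ _

theorem frobenius_norm_sq_eq_trace {m n : ℕ} (X : Matrix (Fin m) (Fin n) ℝ) :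
    ‖X‖ ^ 2 = (Xᵀ * X).trace := by
  rw [frobenius_norm_sq, Finset.sum_comm]
  simp [Matrix.trace, Matrix.mul_apply, sq]

theorem norm_toLp_sq {n : ℕ} (v : Fin n → ℝ) : ‖WithLp.toLp 2 v‖ ^ 2 = v ⬝ᵥ v := by
  rw [EuclideanSpace.norm_sq_eq]
  simp [dotProduct, sq]

theorem norm_toLp_mulVec_of_orthonormal {m n : ℕ} {W : Matrix (Fin m) (Fin n) ℝ}
    (hW : Wᵀ * W = 1) (v : Fin n → ℝ) : ‖WithLp.toLp 2 (W *ᵥ v)‖ = ‖WithLp.toLp 2 v‖ := by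
  refine (sq_eq_sq₀ (norm_nonneg _) (norm_nonneg _)).1 ?_
  rw [norm_toLp_sq, norm_toLp_sq, Matrix.dotProduct_mulVec, Matrix.vecMul_mulVec, hW,
    Matrix.vecMul_one]

/-- Pythagoras: `‖v - WWᵀv‖² = ‖v‖² - ‖Wᵀv‖²` is nonnegative. -/
theorem norm_toLp_transpose_mulVec_le {m n : ℕ} {W : Matrix (Fin m) (Fin n) ℝ}
    (hW : Wᵀ * W = 1) (v : Fin m → ℝ) : ‖WithLp.toLp 2 (Wᵀ *ᵥ v)‖ ≤ ‖WithLp.toLp 2 v‖ := by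
  refine (sq_le_sq₀ (norm_nonneg _) (norm_nonneg _)).1 ?_
  have h1 : ‖WithLp.toLp 2 (W *ᵥ (Wᵀ *ᵥ v))‖ ^ 2 = ‖WithLp.toLp 2 (Wᵀ *ᵥ v)‖ ^ 2 := by
    rw [norm_toLp_mulVec_of_orthonormal hW]
  have h2 : v ⬝ᵥ (W *ᵥ (Wᵀ *ᵥ v)) = ‖WithLp.toLp 2 (Wᵀ *ᵥ v)‖ ^ 2 := by
    rw [Matrix.dotProduct_mulVec, ← Matrix.mulVec_transpose, norm_toLp_sq]
  have h3 : 0 ≤ ‖WithLp.toLp 2 (v - W *ᵥ (Wᵀ *ᵥ v))‖ ^ 2 := by positivity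
  rw [norm_toLp_sq, sub_dotProduct, dotProduct_sub, dotProduct_sub, ← norm_toLp_sq,
    dotProduct_comm _ v, h2, ← norm_toLp_sq, h1] at h3
  linarith

theorem sum_row_sq_le_one {m n : ℕ} {T : Matrix (Fin m) (Fin n) ℝ} (hT : Tᵀ * T = 1) (k : Fin m) :
    ∑ z, T k z ^ 2 ≤ 1 := by
  have h := norm_toLp_transpose_mulVec_le hT (Pi.single k 1)
  have h2 := (sq_le_sq₀ (norm_nonneg _) (norm_nonneg _)).2 h
  rw [norm_toLp_sq, norm_toLp_sq] at h2
  have h3 : (Pi.single k 1 : Fin m → ℝ) ⬝ᵥ Pi.single k 1 = 1 := by simp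
  rw [h3] at h2
  simpa [dotProduct, sq] using h2

theorem frobenius_norm_sq_of_orthonormal {m n : ℕ} {T : Matrix (Fin m) (Fin n) ℝ}
    (hT : Tᵀ * T = 1) : ‖T‖ ^ 2 = n := by
  rw [frobenius_norm_sq_eq_trace, hT]
  simp

theorem norm_proj_sub_proj_sq {m n : ℕ} {U W : Matrix (Fin m) (Fin n) ℝ}
    (hU : Uᵀ * U = 1) (hW : Wᵀ * W = 1) :
    ‖U * Uᵀ - W * Wᵀ‖ ^ 2 = 2 * n - 2 * ‖Uᵀ * W‖ ^ 2 := by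
  have hUU : U * Uᵀ * (U * Uᵀ) = U * Uᵀ := by
    rw [Matrix.mul_assoc, ← Matrix.mul_assoc Uᵀ, hU, Matrix.one_mul]
  have hWW : W * Wᵀ * (W * Wᵀ) = W * Wᵀ := by
    rw [Matrix.mul_assoc, ← Matrix.mul_assoc Wᵀ, hW, Matrix.one_mul]
  have htU : (U * Uᵀ).trace = n := by rw [Matrix.trace_mul_comm, hU]; simp
  have htW : (W * Wᵀ).trace = n := by rw [Matrix.trace_mul_comm, hW]; simp
  have hc : (U * Uᵀ * (W * Wᵀ)).trace = ‖Uᵀ * W‖ ^ 2 := by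
    rw [frobenius_norm_sq_eq_trace, Matrix.transpose_mul, Matrix.transpose_transpose,
      ← Matrix.mul_assoc, Matrix.trace_mul_comm]
    simp only [Matrix.mul_assoc]
  have hc' : (W * Wᵀ * (U * Uᵀ)).trace = ‖Uᵀ * W‖ ^ 2 := by rw [Matrix.trace_mul_comm, hc]
  rw [frobenius_norm_sq_eq_trace]
  simp only [Matrix.transpose_sub, Matrix.transpose_mul, Matrix.transpose_transpose,
    Matrix.sub_mul, Matrix.mul_sub, Matrix.trace_sub, hUU, hWW, htU, htW, hc, hc']
  ring

theorem transpose_mul_self_of_orthonormalBasis {n : ℕ} {ι : Type*} [Fintype ι] [DecidableEq ι]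
    (b : OrthonormalBasis ι ℝ (EuclideanSpace ℝ (Fin n))) :
    (Matrix.of fun i k => b k i)ᵀ * (Matrix.of fun i k => b k i) = 1 := by
  ext k l
  have h := b.inner_eq_ite k l
  rw [PiLp.inner_apply] at h
  simpa [Matrix.mul_apply, Matrix.one_apply, mul_comm] using h

/-- Every contraction `K` admits an orthogonal matrix `O` with `‖K‖² ≤ Tr(OᵀK)`. -/
theorem exists_orthogonal_norm_sq_le_trace {n : ℕ} (K : Matrix (Fin n) (Fin n) ℝ)
    (hK : ∀ v, ‖WithLp.toLp 2 (K *ᵥ v)‖ ≤ ‖WithLp.toLp 2 v‖) :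
    ∃ O ∈ Matrix.orthogonalGroup (Fin n) ℝ, ‖K‖ ^ 2 ≤ (Oᵀ * K).trace := by
  have hS : (Kᵀ * K).IsHermitian := by
    simp [Matrix.IsHermitian, Matrix.conjTranspose_eq_transpose_of_trivial]
  set e := hS.eigenvectorBasis with he
  -- A singular value decomposition by hand: the images `K e_i` of the eigenvectors of `KᵀK` are
  -- pairwise orthogonal, and their lengths are the singular values.
  let w : Fin n → EuclideanSpace ℝ (Fin n) := fun i => WithLp.toLp 2 (K *ᵥ (e i).ofLp)
  have hw : ∀ i j, i ≠ j → inner ℝ (w i) (w j) = 0 := by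
    intro i j hij
    have h1 : inner ℝ (e i) (e j) = 0 := e.inner_eq_zero hij
    have h2 : K *ᵥ (e j).ofLp ⬝ᵥ K *ᵥ (e i).ofLp =
        hS.eigenvalues j * ((e j).ofLp ⬝ᵥ (e i).ofLp) := by
      rw [← smul_eq_mul, ← smul_dotProduct, he, ← hS.mulVec_eigenvectorBasis j,
        ← Matrix.mulVec_mulVec, Matrix.mulVec_transpose, ← Matrix.dotProduct_mulVec]
    have h3 : (e j).ofLp ⬝ᵥ (e i).ofLp = 0 := by
      simpa [EuclideanSpace.inner_eq_star_dotProduct] using h1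
    rw [EuclideanSpace.inner_eq_star_dotProduct]
    simp only [star_trivial, w]
    rw [h2, h3, mul_zero]
  -- Zero singular values give no left singular vector, so only the nonzero images are normalised
  -- and the family is completed. The orthogonal matrix sends `e_i` to `b_i`.
  obtain ⟨b, hb⟩ := Orthonormal.exists_orthonormalBasis_extension_of_card_eq (𝕜 := ℝ)
    (E := EuclideanSpace ℝ (Fin n)) (ι := Fin n) (by simp)
    (v := fun i => ‖w i‖⁻¹ • w i) (s := {i | w i ≠ 0}) (by
      constructor
      · rintro ⟨i, hi⟩
        have : ‖w i‖ ≠ 0 := norm_ne_zero_iff.2 hi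
        simp [Set.domRestrict, norm_smul, this]
      · rintro ⟨i, hi⟩ ⟨j, hj⟩ hij
        have : i ≠ j := fun h => hij (Subtype.ext h)
        simp [Set.domRestrict, real_inner_smul_left, real_inner_smul_right, hw i j this])
  have hwb : ∀ i, inner ℝ (b i) (w i) = ‖w i‖ := by
    intro i
    by_cases hi : w i = 0
    · simp [hi]
    · have : ‖w i‖ ≠ 0 := norm_ne_zero_iff.2 hi
      rw [hb i hi, real_inner_smul_left, real_inner_self_eq_norm_sq]
      field_simp
  set Bm : Matrix (Fin n) (Fin n) ℝ := Matrix.of fun i k => b k i with hBm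
  set Em : Matrix (Fin n) (Fin n) ℝ := Matrix.of fun i k => e k i
  have hB : Bmᵀ * Bm = 1 := transpose_mul_self_of_orthonormalBasis b
  have hE : Emᵀ * Em = 1 := transpose_mul_self_of_orthonormalBasis e
  have hE' : Em * Emᵀ = 1 := mul_eq_one_comm.1 hE
  have hcol : ∀ i k, (K * Em) i k = w k i := fun i k => by
    simp [w, Em, Matrix.mul_apply, Matrix.mulVec, dotProduct]
  refine ⟨Bm * Emᵀ, ?_, ?_⟩
  · rw [Matrix.mem_orthogonalGroup_iff']
    rw [Matrix.transpose_mul, Matrix.transpose_transpose, Matrix.mul_assoc, ← Matrix.mul_assoc Bmᵀ,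
      hB, Matrix.one_mul, hE']
  · have htr : ((Bm * Emᵀ)ᵀ * K).trace = ∑ k, ‖w k‖ := by
      rw [Matrix.transpose_mul, Matrix.transpose_transpose, Matrix.mul_assoc,
        Matrix.trace_mul_comm, Matrix.mul_assoc]
      refine Finset.sum_congr rfl fun k _ => ?_
      rw [← hwb k, PiLp.inner_apply, Matrix.diag_apply, Matrix.mul_apply]
      refine Finset.sum_congr rfl fun i _ => ?_
      rw [hcol, Matrix.transpose_apply, hBm]
      simp [mul_comm]
    have hnorm : ‖K‖ ^ 2 = ∑ k, ‖w k‖ ^ 2 := by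
      have : ‖K‖ ^ 2 = ‖K * Em‖ ^ 2 := by
        rw [frobenius_norm_sq_eq_trace, frobenius_norm_sq_eq_trace, Matrix.transpose_mul,
          Matrix.mul_assoc, Matrix.trace_mul_comm Emᵀ, Matrix.mul_assoc, Matrix.mul_assoc, hE',
          Matrix.mul_one]
      rw [this, frobenius_norm_sq, Finset.sum_comm]
      simp only [hcol, EuclideanSpace.norm_sq_eq, Real.norm_eq_abs, sq_abs]
    rw [htr, hnorm]
    -- Singular values of a contraction satisfy `σ² ≤ σ`.
    refine Finset.sum_le_sum fun k _ => ?_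
    have h1 : ‖w k‖ ≤ 1 := (hK _).trans (e.norm_eq_one k).le
    nlinarith [norm_nonneg (w k)]

/-- Two matrices with orthonormal columns can be aligned by an orthogonal matrix up to the
distance of their column-space projections. -/
theorem exists_orthogonal_norm_mul_sub_le {m n : ℕ} {U W : Matrix (Fin m) (Fin n) ℝ}
    (hU : Uᵀ * U = 1) (hW : Wᵀ * W = 1) :
    ∃ O ∈ Matrix.orthogonalGroup (Fin n) ℝ, ‖U * O - W‖ ≤ ‖U * Uᵀ - W * Wᵀ‖ := by
  obtain ⟨O, hO, h⟩ := exists_orthogonal_norm_sq_le_trace (Uᵀ * W) fun v => by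
    rw [← Matrix.mulVec_mulVec]
    exact (norm_toLp_transpose_mulVec_le hU _).trans (norm_toLp_mulVec_of_orthonormal hW v).le
  refine ⟨O, hO, (sq_le_sq₀ (norm_nonneg _) (norm_nonneg _)).1 ?_⟩
  rw [norm_proj_sub_proj_sq hU hW]
  have hOO : Oᵀ * O = 1 := (Matrix.mem_orthogonalGroup_iff' (Fin n) ℝ).1 hO
  have h1 : (Oᵀ * Uᵀ * (U * O)).trace = n := by
    rw [Matrix.mul_assoc, ← Matrix.mul_assoc Uᵀ, hU, Matrix.one_mul, hOO]; simp
  have h2 : (Wᵀ * (U * O)).trace = (Oᵀ * (Uᵀ * W)).trace := by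
    rw [← Matrix.trace_transpose]
    simp [Matrix.mul_assoc]
  have h3 : (Oᵀ * Uᵀ * W).trace = (Oᵀ * (Uᵀ * W)).trace := by rw [Matrix.mul_assoc]
  -- Here `‖UO - W‖² = 2n - 2 Tr(OᵀUᵀW)`, to be compared with `2n - 2‖UᵀW‖²`.
  rw [frobenius_norm_sq_eq_trace]
  simp only [Matrix.transpose_sub, Matrix.transpose_mul,
    Matrix.sub_mul, Matrix.mul_sub, Matrix.trace_sub, h1, h2, h3, hW, Matrix.trace_one,
    Fintype.card_fin]
  linarith

end Orthonormal

/-! ### Eigengap and stability of PCA solutions. -/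

section PCA

open scoped Matrix.Norms.Frobenius

/-- The weights have total mass `Z` and at most 1 per index. The mass missing from the top `Z`
indices sits below them, and each unit of it costs at least the gap. Indices start at 0, so `Z - 1`
and `Z` are the `Z`-th and `(Z+1)`-th values. -/
theorem sum_top_sub_weighted_sum_ge {M Z : ℕ} (hZ : 1 ≤ Z) (hZM : Z + 1 ≤ M) {l : Fin M → ℝ}
    (hl : Antitone l) {p : Fin M → ℝ} (hp0 : ∀ k, 0 ≤ p k) (hp1 : ∀ k, p k ≤ 1)
    (hp : ∑ k, p k = Z) :
    (l ⟨Z - 1, by omega⟩ - l ⟨Z, by omega⟩) *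
        (Z - ∑ z : Fin Z, p (Fin.castLE (Nat.le_of_succ_le hZM) z)) ≤
      ∑ z : Fin Z, l (Fin.castLE (Nat.le_of_succ_le hZM) z) - ∑ k, l k * p k := by
  obtain ⟨r, rfl⟩ := Nat.exists_eq_add_of_le (Nat.le_of_succ_le hZM)
  rw [Fin.sum_univ_add] at hp ⊢
  set ν := l ⟨Z - 1, by omega⟩
  set μ := l ⟨Z, by omega⟩
  have h1 : ∑ z : Fin Z, ν * (1 - p (Fin.castAdd r z)) ≤
      ∑ z : Fin Z, l (Fin.castAdd r z) * (1 - p (Fin.castAdd r z)) := by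
    refine Finset.sum_le_sum fun z _ => mul_le_mul_of_nonneg_right (hl ?_) ?_
    · rw [Fin.le_def]; simp; omega
    · linarith [hp1 (Fin.castAdd r z)]
  have h2 : ∑ z : Fin r, l (Fin.natAdd Z z) * p (Fin.natAdd Z z) ≤
      ∑ z : Fin r, μ * p (Fin.natAdd Z z) := by
    refine Finset.sum_le_sum fun z _ => mul_le_mul_of_nonneg_right (hl ?_) (hp0 _)
    rw [Fin.le_def]; simp
  rw [← Finset.mul_sum] at h1 h2
  simp only [mul_sub, Finset.sum_sub_distrib, mul_one, Finset.sum_const, Finset.card_univ,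
    Fintype.card_fin, nsmul_eq_mul] at h1
  have h3 : ∑ z : Fin r, p (Fin.natAdd Z z) = Z - ∑ z : Fin Z, p (Fin.castAdd r z) := by linarith
  rw [h3] at h2
  change (ν - μ) * (Z - ∑ z : Fin Z, p (Fin.castAdd r z)) ≤
    ∑ z : Fin Z, l (Fin.castAdd r z) - _
  linarith

theorem exists_orthogonal_diagonalisation {M : ℕ} {A : Matrix (Fin M) (Fin M) ℝ}
    (hA : A.IsHermitian) :
    ∃ B : Matrix (Fin M) (Fin M) ℝ, Bᵀ * B = 1 ∧
      A = B * Matrix.diagonal (sortedEigenvalue hA) * Bᵀ := by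
  let σ : Fin M ≃ Fin M := (finCongr (Fintype.card_fin M).symm).trans
    (Fintype.equivOfCardEq (Fintype.card_fin _))
  let b := hA.eigenvectorBasis.reindex σ.symm
  have hB := transpose_mul_self_of_orthonormalBasis b
  set B : Matrix (Fin M) (Fin M) ℝ := Matrix.of fun i k => b k i
  have hAB : A * B = B * Matrix.diagonal (sortedEigenvalue hA) := by
    ext i k
    have h := congrFun (hA.mulVec_eigenvectorBasis (σ k)) i
    have hs : hA.eigenvalues (σ k) = sortedEigenvalue hA k := by
      simp [Matrix.IsHermitian.eigenvalues, sortedEigenvalue, σ]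
    rw [hs] at h
    rw [Matrix.mul_diagonal, mul_comm]
    simpa [B, b, Matrix.mul_apply, Matrix.mulVec, dotProduct] using h
  refine ⟨B, hB, ?_⟩
  rw [← hAB, Matrix.mul_assoc, mul_eq_one_comm.1 hB, Matrix.mul_one]

theorem sortedEigenvalue_antitone {M : ℕ} {A : Matrix (Fin M) (Fin M) ℝ} (hA : A.IsHermitian) :
    Antitone (sortedEigenvalue hA) := fun _ _ h => hA.eigenvalues₀_antitone h

/-- The frame of leading eigenvectors beats every other orthonormal frame by at least the
eigengap times the squared sine distance. -/
theorem exists_frame_gap_mul_le {M Z : ℕ} (hZ : 1 ≤ Z) (hZM : Z + 1 ≤ M)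
    {A : Matrix (Fin M) (Fin M) ℝ} (hA : A.IsHermitian) :
    ∃ U : Matrix (Fin M) (Fin Z) ℝ, Uᵀ * U = 1 ∧ ∀ W : Matrix (Fin M) (Fin Z) ℝ, Wᵀ * W = 1 →
      (sortedEigenvalue hA ⟨Z - 1, by omega⟩ - sortedEigenvalue hA ⟨Z, by omega⟩) *
        (Z - ‖Uᵀ * W‖ ^ 2) ≤ (Uᵀ * A * U).trace - (Wᵀ * A * W).trace := by
  obtain ⟨B, hB, hAB⟩ := exists_orthogonal_diagonalisation hA
  set l := sortedEigenvalue hA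
  let c : Fin Z → Fin M := Fin.castLE (Nat.le_of_succ_le hZM)
  have hc : Function.Injective c := Fin.castLE_injective _
  have hBB : B * Bᵀ = 1 := mul_eq_one_comm.1 hB
  -- In the eigenbasis the trace is a weighted sum of eigenvalues; the weights are the squared row
  -- norms of `BᵀW`.
  have htr : ∀ W : Matrix (Fin M) (Fin Z) ℝ, (Wᵀ * A * W).trace
      = ∑ k, l k * ∑ z, (Bᵀ * W) k z ^ 2 := by
    intro W
    have : Wᵀ * A * W = (Bᵀ * W)ᵀ * (Matrix.diagonal l * (Bᵀ * W)) := by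
      rw [hAB]
      simp only [Matrix.transpose_mul, Matrix.transpose_transpose, Matrix.mul_assoc]
    rw [this]
    simp only [Matrix.trace, Matrix.diag, Matrix.mul_apply (M := (Bᵀ * W)ᵀ),
      Matrix.diagonal_mul, Matrix.transpose_apply]
    rw [Finset.sum_comm]
    refine Finset.sum_congr rfl fun k _ => ?_
    rw [Finset.mul_sum]
    exact Finset.sum_congr rfl fun z _ => by ring
  have hcol : ∀ k z, (Bᵀ * B.submatrix id c) k z = if k = c z then 1 else 0 := by
    intro k z
    rw [← Matrix.one_apply, ← hB]
    rfl
  refine ⟨B.submatrix id c, ?_, fun W hW => ?_⟩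
  · have : (B.submatrix id c)ᵀ * B.submatrix id c = (Bᵀ * B).submatrix c c := by
      ext i j; rfl
    rw [this, hB, Matrix.submatrix_one c hc]
  · have hT : (Bᵀ * W)ᵀ * (Bᵀ * W) = 1 := by
      rw [Matrix.transpose_mul, Matrix.transpose_transpose, Matrix.mul_assoc,
        ← Matrix.mul_assoc B, hBB, Matrix.one_mul, hW]
    have hUW : ‖(B.submatrix id c)ᵀ * W‖ ^ 2 = ∑ z, ∑ y, (Bᵀ * W) (c z) y ^ 2 := by
      rw [frobenius_norm_sq]; rfl
    have hUU : ((B.submatrix id c)ᵀ * A * B.submatrix id c).trace = ∑ z, l (c z) := by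
      rw [htr]
      simp only [hcol, Finset.mul_sum]
      rw [Finset.sum_comm]
      simp
    rw [htr W, hUU, hUW]
    refine sum_top_sub_weighted_sum_ge hZ hZM (sortedEigenvalue_antitone hA)
      (fun k => by positivity) (fun k => sum_row_sq_le_one hT k) ?_
    rw [← frobenius_norm_sq, frobenius_norm_sq_of_orthonormal hT]

theorem trace_transpose_mul_mul {M Z : ℕ} (A : Matrix (Fin M) (Fin M) ℝ)
    (W : Matrix (Fin M) (Fin Z) ℝ) : (Wᵀ * A * W).trace = (A * (W * Wᵀ)).trace := by
  rw [Matrix.mul_assoc, Matrix.trace_mul_comm, Matrix.mul_assoc]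

/-- A Davis–Kahan bound for PCA solutions, with the eigengap taken from one of the two
matrices only. -/
theorem gap_mul_norm_proj_sub_proj_le {M Z : ℕ} (hZ : 1 ≤ Z) (hZM : Z + 1 ≤ M)
    {A A' : Matrix (Fin M) (Fin M) ℝ} (hA : A.IsHermitian)
    (hgap : sortedEigenvalue hA ⟨Z, by omega⟩ < sortedEigenvalue hA ⟨Z - 1, by omega⟩)
    {W W' : Matrix (Fin M) (Fin Z) ℝ} (hW : IsPCASolution A W) (hW' : IsPCASolution A' W') :
    (sortedEigenvalue hA ⟨Z - 1, by omega⟩ - sortedEigenvalue hA ⟨Z, by omega⟩) *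
      ‖W' * W'ᵀ - W * Wᵀ‖ ≤ 2 * ‖A' - A‖ := by
  obtain ⟨U, hU, h⟩ := exists_frame_gap_mul_le hZ hZM hA
  set g := sortedEigenvalue hA ⟨Z - 1, by omega⟩ - sortedEigenvalue hA ⟨Z, by omega⟩
  have hg0 : 0 < g := sub_pos.2 hgap
  -- With a positive gap the optimal subspace is unique, so `W` spans the leading eigenspace.
  have hUW : U * Uᵀ = W * Wᵀ := by
    have h1 := h W hW.1
    have h2 := hW.2 U hU
    have h3 := norm_proj_sub_proj_sq hU hW.1
    have h4 : ‖U * Uᵀ - W * Wᵀ‖ ^ 2 ≤ 0 := by nlinarith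
    rw [← sub_eq_zero, ← norm_eq_zero]
    exact pow_eq_zero_iff two_ne_zero |>.1 (le_antisymm h4 (sq_nonneg _))
  have h1 := h W' hW'.1
  have h2 := norm_proj_sub_proj_sq hU hW'.1
  have h3 := hW'.2 W hW.1
  have h4 := trace_transpose_mul_le (A' - A)ᵀ (W' * W'ᵀ - W * Wᵀ)
  rw [hUW, norm_sub_rev] at h2
  rw [Matrix.transpose_transpose, Matrix.frobenius_norm_transpose] at h4
  simp only [trace_transpose_mul_mul, hUW, Matrix.sub_mul, Matrix.mul_sub, Matrix.trace_sub]
    at h1 h3 h4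
  -- With `P = WWᵀ` and `P' = W'W'ᵀ`: the gap gives `g‖P' - P‖²/2 ≤ Tr(A(P - P'))`, and optimality
  -- of `W'` for `A'` bounds this by `Tr((A' - A)(P' - P))`. No gap of `A'` is needed.
  have h5 : g * ‖W' * W'ᵀ - W * Wᵀ‖ ^ 2 ≤ 2 * (‖A' - A‖ * ‖W' * W'ᵀ - W * Wᵀ‖) := by
    rw [h2]
    linarith
  rcases (norm_nonneg (W' * W'ᵀ - W * Wᵀ)).eq_or_lt with h0 | h0
  · rw [← h0]; simp
  · nlinarith

end PCA

/-! ### Lipschitz dependence of the loss and the contrast matrix on `V`. -/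

section Features

open scoped Matrix.Norms.Frobenius

variable {D M Z N Q : ℕ} {φ : ℝ → ℝ} {Lφ : NNReal} {δ cin : ℝ} {α : Fin Q → ℝ}
  {x : Fin N → Fin D → ℝ} {xp : Fin N → Fin Q → Fin D → ℝ}

theorem norm_feature_sub_le (hφL : LipschitzWith Lφ φ) (V V' : Matrix (Fin M) (Fin D) ℝ)
    {y : Fin D → ℝ} (hy : ‖y‖ ≤ cin) :
    ‖WithLp.toLp 2 (feature φ V y) - WithLp.toLp 2 (feature φ V' y)‖ ≤
      Lφ * √D * cin * ‖V - V'‖ := by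
  have hcin : 0 ≤ cin := (norm_nonneg y).trans hy
  have h1 : ‖WithLp.toLp 2 (feature φ V y) - WithLp.toLp 2 (feature φ V' y)‖ ≤
      Lφ * ‖WithLp.toLp 2 ((V - V') *ᵥ y)‖ := by
    refine (sq_le_sq₀ (norm_nonneg _) (by positivity)).1 ?_
    rw [mul_pow, EuclideanSpace.norm_sq_eq, EuclideanSpace.norm_sq_eq, Finset.mul_sum]
    refine Finset.sum_le_sum fun i _ => ?_
    rw [← mul_pow]
    have := hφL.norm_sub_le ((V *ᵥ y) i) ((V' *ᵥ y) i)
    gcongr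
    simpa [feature, Matrix.sub_mulVec] using this
  have h2 : ‖WithLp.toLp 2 y‖ ≤ √D * cin :=
    norm_toLp_le_sqrt_mul (fun i => (norm_le_pi_norm y i).trans hy) hcin
  calc _ ≤ Lφ * (‖V - V'‖ * (√D * cin)) := by
        refine h1.trans (mul_le_mul_of_nonneg_left ?_ Lφ.coe_nonneg)
        exact (norm_toLp_mulVec_le _ _).trans (by gcongr)
    _ = _ := by ring

theorem norm_feature_le (hφL : LipschitzWith Lφ φ) {V : Matrix (Fin M) (Fin D) ℝ} {c : ℝ}
    (hV : ∀ i j, |V i j| ≤ c) (hc : 0 ≤ c) {y : Fin D → ℝ} (hy : ‖y‖ ≤ cin) :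
    ‖WithLp.toLp 2 (feature φ V y)‖ ≤ √M * (|φ 0| + Lφ * (D * (c * cin))) := by
  have hcin : 0 ≤ cin := (norm_nonneg y).trans hy
  refine norm_toLp_le_sqrt_mul (fun i => ?_) (by positivity)
  have h1 : |(V *ᵥ y) i| ≤ D * (c * cin) := by
    calc |(V *ᵥ y) i| = |∑ j, V i j * y j| := rfl
      _ ≤ ∑ j, |V i j * y j| := Finset.abs_sum_le_sum_abs _ _
      _ ≤ ∑ _j : Fin D, c * cin := by
        gcongr with j
        rw [abs_mul]
        exact mul_le_mul (hV i j) ((norm_le_pi_norm y j).trans hy) (abs_nonneg _) hc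
      _ = _ := by simp
  have h2 : |φ ((V *ᵥ y) i) - φ 0| ≤ Lφ * |(V *ᵥ y) i| := by
    simpa using hφL.norm_sub_le ((V *ᵥ y) i) 0
  calc |φ ((V *ᵥ y) i)| = |φ 0 + (φ ((V *ᵥ y) i) - φ 0)| := by ring_nf
    _ ≤ |φ 0| + |φ ((V *ᵥ y) i) - φ 0| := abs_add_le _ _
    _ ≤ _ := by gcongr; exact h2.trans (by gcongr)

theorem softNormalize_feature (V : Matrix (Fin M) (Fin D) ℝ) (y : Fin D → ℝ) :
    (softNormalize (√M * δ) (WithLp.toLp 2 (feature φ V y))).ofLp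
      = (normaliser φ δ V y)⁻¹ • feature φ V y := rfl

/-- The form `(u, v) ↦ (Wᵀu)ᵀ(Wᵀv)`. -/
noncomputable def projForm (W : Matrix (Fin M) (Fin Z) ℝ) :
    EuclideanSpace ℝ (Fin M) →ₗ[ℝ] EuclideanSpace ℝ (Fin M) →ₗ[ℝ] ℝ :=
  LinearMap.mk₂ ℝ (fun u v => (Wᵀ *ᵥ u.ofLp) ⬝ᵥ (Wᵀ *ᵥ v.ofLp))
    (fun _ _ _ => by simp [Matrix.mulVec_add]) (fun _ _ _ => by simp [Matrix.mulVec_smul])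
    (fun _ _ _ => by simp [Matrix.mulVec_add]) (fun _ _ _ => by simp [Matrix.mulVec_smul])

/-- The form `(u, v) ↦ vuᵀ`. -/
noncomputable def outerForm (M : ℕ) :
    EuclideanSpace ℝ (Fin M) →ₗ[ℝ] EuclideanSpace ℝ (Fin M) →ₗ[ℝ] Matrix (Fin M) (Fin M) ℝ :=
  LinearMap.mk₂ ℝ (fun u v => Matrix.vecMulVec v.ofLp u.ofLp)
    (fun _ _ _ => by simp [Matrix.vecMulVec_add]) (fun _ _ _ => by simp [Matrix.vecMulVec_smul])
    (fun _ _ _ => by simp [Matrix.add_vecMulVec]) (fun _ _ _ => by simp [Matrix.smul_vecMulVec])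

theorem norm_projForm_le {W : Matrix (Fin M) (Fin Z) ℝ} (hW : Wᵀ * W = 1)
    (u v : EuclideanSpace ℝ (Fin M)) : ‖projForm W u v‖ ≤ ‖u‖ * ‖v‖ := by
  have h := abs_real_inner_le_norm (WithLp.toLp 2 (Wᵀ *ᵥ v.ofLp)) (WithLp.toLp 2 (Wᵀ *ᵥ u.ofLp))
  rw [EuclideanSpace.inner_eq_star_dotProduct] at h
  refine h.trans ?_
  rw [mul_comm]
  exact mul_le_mul (norm_toLp_transpose_mulVec_le hW _) (norm_toLp_transpose_mulVec_le hW _)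
    (norm_nonneg _) (norm_nonneg _)

theorem norm_outerForm_le (u v : EuclideanSpace ℝ (Fin M)) :
    ‖outerForm M u v‖ ≤ ‖u‖ * ‖v‖ := by
  rw [mul_comm]
  exact norm_vecMulVec_le _ _

theorem similarity_eq (W : Matrix (Fin M) (Fin Z) ℝ) (V : Matrix (Fin M) (Fin D) ℝ)
    (y z : Fin D → ℝ) :
    similarity φ δ W V y z =
      projForm W (softNormalize (√M * δ) (WithLp.toLp 2 (feature φ V y)))
        (softNormalize (√M * δ) (WithLp.toLp 2 (feature φ V z))) := by
  simp only [projForm, LinearMap.mk₂_apply, softNormalize_feature, Matrix.mulVec_smul,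
    smul_dotProduct, dotProduct_smul, similarity, smul_eq_mul]
  rw [div_eq_mul_inv, mul_inv]
  ring

theorem contrastMatrix_eq (V : Matrix (Fin M) (Fin D) ℝ) :
    contrastMatrix φ δ α x xp V = (1 / (N : ℝ)) • ∑ n, ∑ q, α q •
      outerForm M (softNormalize (√M * δ) (WithLp.toLp 2 (feature φ V (x n))))
        (softNormalize (√M * δ) (WithLp.toLp 2 (feature φ V (xp n q)))) := by
  simp only [outerForm, LinearMap.mk₂_apply, softNormalize_feature, contrastMatrix,
    Matrix.smul_vecMulVec, Matrix.vecMulVec_smul, smul_smul]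
  congr 1
  refine Finset.sum_congr rfl fun n _ => Finset.sum_congr rfl fun q _ => ?_
  congr 1
  rw [div_eq_mul_inv, mul_inv]
  ring

/-- An average over `n` of `Q` signed terms moves by at most `Q` times the movement of one term. -/
theorem norm_signed_average_sub_le {F : Type*} [NormedAddCommGroup F] [NormedSpace ℝ F]
    (hα : ∀ q, α q = 1 ∨ α q = -1) {f g : Fin N → Fin Q → F} {K : ℝ} (hK : 0 ≤ K)
    (h : ∀ n q, ‖f n q - g n q‖ ≤ K) :
    ‖(1 / (N : ℝ)) • ∑ n, ∑ q, α q • f n q - (1 / (N : ℝ)) • ∑ n, ∑ q, α q • g n q‖ ≤ Q * K := by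
  have h1 : ‖∑ n, ∑ q, α q • (f n q - g n q)‖ ≤ N * (Q * K) := by
    calc _ ≤ ∑ _n : Fin N, ∑ _q : Fin Q, K := by
          refine norm_sum_le_of_le _ fun n _ => norm_sum_le_of_le _ fun q _ => ?_
          rw [norm_smul]
          rcases hα q with h' | h' <;> simpa [h'] using h n q
      _ = _ := by simp
  rw [← smul_sub]
  simp only [← Finset.sum_sub_distrib, ← smul_sub]
  rw [norm_smul, Real.norm_of_nonneg (by positivity)]
  -- For `N = 0` the factor `1 / N` is 0 and both averages vanish.
  rcases Nat.eq_zero_or_pos N with rfl | hN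
  · simp; positivity
  · calc _ ≤ 1 / (N : ℝ) * (N * (Q * K)) := by gcongr
      _ = Q * K := by field_simp

theorem loss_eq (W : Matrix (Fin M) (Fin Z) ℝ) (V : Matrix (Fin M) (Fin D) ℝ) :
    loss φ δ α x xp W V =
      -((1 / (N : ℝ)) • ∑ n, ∑ q, α q • similarity φ δ W V (x n) (xp n q)) := rfl

theorem abs_loss_sub_le (hφL : LipschitzWith Lφ φ) (hδ : 0 < δ) (hM : 0 < M) (hcin : 0 ≤ cin)
    (hα : ∀ q, α q = 1 ∨ α q = -1) (hx : ∀ n, ‖x n‖ ≤ cin) (hxp : ∀ n q, ‖xp n q‖ ≤ cin)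
    {W : Matrix (Fin M) (Fin Z) ℝ} (hW : Wᵀ * W = 1) (V V' : Matrix (Fin M) (Fin D) ℝ) :
    |loss φ δ α x xp W V - loss φ δ α x xp W V'| ≤
      Q * ((√M * δ)⁻¹ * (Lφ * √D * cin)) * ‖V - V'‖ := by
  rw [loss_eq, loss_eq, neg_sub_neg, abs_sub_comm, ← Real.norm_eq_abs]
  refine (norm_signed_average_sub_le hα
    (K := (√M * δ)⁻¹ * (Lφ * √D * cin * ‖V - V'‖)) (by positivity) fun n q => ?_).trans
    (by apply le_of_eq; ring)
  rw [similarity_eq, similarity_eq]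
  exact norm_bilin_softNormalize_sub_le (by positivity) _ (norm_projForm_le hW)
    (norm_feature_sub_le hφL V V' (hx n)) (norm_feature_sub_le hφL V V' (hxp n q))

theorem norm_contrastMatrix_sub_le (hφL : LipschitzWith Lφ φ) (hδ : 0 < δ) (hM : 0 < M)
    (hcin : 0 ≤ cin) (hα : ∀ q, α q = 1 ∨ α q = -1) (hx : ∀ n, ‖x n‖ ≤ cin)
    (hxp : ∀ n q, ‖xp n q‖ ≤ cin) (V V' : Matrix (Fin M) (Fin D) ℝ) :
    ‖contrastMatrix φ δ α x xp V - contrastMatrix φ δ α x xp V'‖ ≤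
      Q * ((√M * δ)⁻¹ * (Lφ * √D * cin)) * ‖V - V'‖ := by
  rw [contrastMatrix_eq, contrastMatrix_eq]
  refine (norm_signed_average_sub_le hα
    (K := (√M * δ)⁻¹ * (Lφ * √D * cin * ‖V - V'‖)) (by positivity) fun n q => ?_).trans
    (by apply le_of_eq; ring)
  exact norm_bilin_softNormalize_sub_le (by positivity) _ norm_outerForm_le
    (norm_feature_sub_le hφL V V' (hx n)) (norm_feature_sub_le hφL V V' (hxp n q))

theorem norm_symContrastMatrix_sub_le (hφL : LipschitzWith Lφ φ) (hδ : 0 < δ) (hM : 0 < M)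
    (hcin : 0 ≤ cin) (hα : ∀ q, α q = 1 ∨ α q = -1) (hx : ∀ n, ‖x n‖ ≤ cin)
    (hxp : ∀ n q, ‖xp n q‖ ≤ cin) (V V' : Matrix (Fin M) (Fin D) ℝ) :
    ‖symContrastMatrix φ δ α x xp V - symContrastMatrix φ δ α x xp V'‖ ≤
      Q * ((√M * δ)⁻¹ * (Lφ * √D * cin)) * ‖V - V'‖ := by
  refine le_trans ?_ (norm_contrastMatrix_sub_le hφL hδ hM hcin hα hx hxp V V')
  set C := contrastMatrix φ δ α x xp V with hC
  set C' := contrastMatrix φ δ α x xp V' with hC'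
  have e : symContrastMatrix φ δ α x xp V - symContrastMatrix φ δ α x xp V'
      = (1 / 2 : ℝ) • ((C - C') + (C - C')ᵀ) := by
    rw [symContrastMatrix, symContrastMatrix, ← smul_sub, Matrix.transpose_sub, ← hC, ← hC']
    congr 1
    abel
  have h := norm_add_le (C - C') (C - C')ᵀ
  rw [Matrix.frobenius_norm_transpose] at h
  rw [e, norm_smul, Real.norm_of_nonneg (by norm_num)]
  linarith

theorem differentiable_feature (hφd : Differentiable ℝ φ) (y : Fin D → ℝ) :
    Differentiable ℝ (fun B : Fin M → Fin D → ℝ =>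
      WithLp.toLp 2 (feature φ (Matrix.of B) y)) := by
  rw [differentiable_euclidean]
  intro i
  simp only [feature, Matrix.mulVec, dotProduct, Matrix.of_apply]
  fun_prop

theorem differentiable_loss (hφd : Differentiable ℝ φ) (hδ : 0 < δ) (hM : 0 < M)
    (W : Matrix (Fin M) (Fin Z) ℝ) :
    Differentiable ℝ (fun B : Fin M → Fin D → ℝ => loss φ δ α x xp W (Matrix.of B)) := by
  have hs : ∀ (y : Fin D → ℝ), Differentiable ℝ (fun B : Fin M → Fin D → ℝ =>
      softNormalize (√M * δ) (WithLp.toLp 2 (feature φ (Matrix.of B) y))) := fun y =>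
    (differentiable_softNormalize (by positivity)).comp (differentiable_feature hφd y)
  have hs' : ∀ (y : Fin D → ℝ) (i : Fin M), Differentiable ℝ (fun B : Fin M → Fin D → ℝ =>
      (softNormalize (√M * δ) (WithLp.toLp 2 (feature φ (Matrix.of B) y))).ofLp i) := fun y =>
    differentiable_euclidean.1 (hs y)
  simp only [loss_eq, similarity_eq, projForm, LinearMap.mk₂_apply, Matrix.mulVec, dotProduct,
    smul_eq_mul]
  fun_prop

theorem norm_matrixGrad_loss_le (hφL : LipschitzWith Lφ φ) (hφd : Differentiable ℝ φ)
    (hδ : 0 < δ) (hM : 0 < M) (hcin : 0 ≤ cin)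
    (hα : ∀ q, α q = 1 ∨ α q = -1) (hx : ∀ n, ‖x n‖ ≤ cin) (hxp : ∀ n q, ‖xp n q‖ ≤ cin)
    {W : Matrix (Fin M) (Fin Z) ℝ} (hW : Wᵀ * W = 1) (V : Matrix (Fin M) (Fin D) ℝ) :
    ‖matrixGrad (fun V' => loss φ δ α x xp W V') V‖ ≤
      Q * ((√M * δ)⁻¹ * (Lφ * √D * cin)) :=
  norm_matrixGrad_le (by positivity) (differentiable_loss hφd hδ hM W _)
    fun B => abs_loss_sub_le hφL hδ hM hcin hα hx hxp hW B V

end Features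

/-! ### Weights along the training run. -/

section Training

open scoped Matrix.Norms.Frobenius

variable {D M Z N Q : ℕ} {φ : ℝ → ℝ} {Lφ : NNReal} {δ η cin : ℝ} {α : Fin Q → ℝ}
  {x : Fin N → Fin D → ℝ} {xp : Fin N → Fin Q → Fin D → ℝ}
  {R : Matrix (Fin M) (Fin Z) ℝ → Matrix (Fin M) (Fin Z) ℝ → Matrix (Fin M) (Fin Z) ℝ}
  {W : ℕ → Matrix (Fin M) (Fin Z) ℝ} {V : ℕ → Matrix (Fin M) (Fin D) ℝ}

/-- The factor `1 - WWᵀ` makes every step horizontal, which is the condition under which the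
retraction preserves orthonormality. -/
theorem IsTrainingRun.orthonormal (hrun : IsTrainingRun φ δ η α x xp R W V)
    (hR : IsGrassmannRetraction R) (t : ℕ) : (W t)ᵀ * W t = 1 := by
  induction t with
  | zero => exact hrun.init
  | succ t ih =>
    rw [hrun.step_W]
    refine hR.orthonormal _ _ ih ?_
    rw [Matrix.mul_neg, Matrix.mul_smul, ← Matrix.mul_assoc, Matrix.mul_sub, Matrix.mul_one,
      ← Matrix.mul_assoc, ih, Matrix.one_mul, sub_self, Matrix.zero_mul, smul_zero, neg_zero]

theorem IsTrainingRun.norm_sub_init_le (hrun : IsTrainingRun φ δ η α x xp R W V)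
    (hR : IsGrassmannRetraction R) (hφL : LipschitzWith Lφ φ) (hφd : Differentiable ℝ φ)
    (hδ : 0 < δ) (hη : 0 < η) (hM : 0 < M) (hcin : 0 ≤ cin) (hα : ∀ q, α q = 1 ∨ α q = -1)
    (hx : ∀ n, ‖x n‖ ≤ cin) (hxp : ∀ n q, ‖xp n q‖ ≤ cin) (t : ℕ) :
    ‖V t - V 0‖ ≤ t * (η * (Q * ((√M * δ)⁻¹ * (Lφ * √D * cin)))) := by
  induction t with
  | zero => simp
  | succ t ih =>
    have h := norm_matrixGrad_loss_le hφL hφd hδ hM hcin hα hx hxp (hrun.orthonormal hR t) (V t)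
    rw [hrun.step_V, sub_right_comm]
    refine (norm_sub_le _ _).trans ?_
    rw [norm_smul, Real.norm_of_nonneg hη.le]
    have := mul_le_mul_of_nonneg_left h hη.le
    push_cast
    linarith

end Training

/-! ### Perturbation of the representation and comparison of constants. -/

section Assembly

open scoped Matrix.Norms.Frobenius

/-- The difference is split so that the orthonormal frame `W'O` acts on the feature displacement, at
no cost, and the frame displacement acts on the features of `V`, later the initial weights, whose
size is controlled. -/
theorem norm_rotated_representation_sub_le {D M Z : ℕ} (φ : ℝ → ℝ)
    {W W' : Matrix (Fin M) (Fin Z) ℝ} (hW' : W'ᵀ * W' = 1) {O : Matrix (Fin Z) (Fin Z) ℝ}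
    (hO : Oᵀ * O = 1) (V V' : Matrix (Fin M) (Fin D) ℝ) (y : Fin D → ℝ) :
    euclNorm (Oᵀ *ᵥ representation φ W' V' y - representation φ W V y) ≤
      1 / √M * (‖WithLp.toLp 2 (feature φ V' y) - WithLp.toLp 2 (feature φ V y)‖ +
        ‖W' * O - W‖ * ‖WithLp.toLp 2 (feature φ V y)‖) := by
  have hWO : (W' * O)ᵀ * (W' * O) = 1 := by
    rw [Matrix.transpose_mul, Matrix.mul_assoc, ← Matrix.mul_assoc W'ᵀ, hW', Matrix.one_mul, hO]
  have e : Oᵀ *ᵥ representation φ W' V' y - representation φ W V y = (1 / √M) •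
      ((W' * O)ᵀ *ᵥ (feature φ V' y - feature φ V y) + (W' * O - W)ᵀ *ᵥ feature φ V y) := by
    rw [representation, representation, Matrix.mulVec_smul, ← smul_sub, Matrix.mulVec_mulVec,
      ← Matrix.transpose_mul, Matrix.mulVec_sub, Matrix.transpose_sub, Matrix.sub_mulVec]
    congr 1
    abel
  rw [e, euclNorm, WithLp.toLp_smul, norm_smul, Real.norm_of_nonneg (by positivity),
    WithLp.toLp_add, ← WithLp.toLp_sub]
  gcongr
  refine (norm_add_le _ _).trans (add_le_add (norm_toLp_transpose_mulVec_le hWO _) ?_)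
  refine (norm_toLp_mulVec_le _ _).trans_eq ?_
  rw [Matrix.frobenius_norm_transpose]

/-- In the application `m = √M`, `d = √D`, `b = cθ`, `ℓ = log M`, `p = |φ 0|`, `T = t`, `q = Q` and
`g` is the eigengap. -/
theorem perturbation_constant_le {m d δ η c b ℓ g L p T q : ℝ} (hm : 0 < m) (hd : 0 ≤ d)
    (hdm : d ≤ 4 * m) (hδ : 0 < δ) (hη : 0 < η) (hc : 0 ≤ c) (hbℓ : 0 ≤ b * ℓ)
    (hg : 0 < g) (hL : 0 ≤ L) (hT : 0 ≤ T) (hq : 0 ≤ q)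
    (hp0 : 0 ≤ p) (hp : p ≤ 8 * c * (m * d) * ℓ * p) :
    1 / m * (L * d * c * (T * (η * (q * ((m * δ)⁻¹ * (L * d * c))))) +
        2 * (q * ((m * δ)⁻¹ * (L * d * c)) * (T * (η * (q * ((m * δ)⁻¹ * (L * d * c)))))) / g *
          (m * (p + L * (d ^ 2 * (b * ℓ * c))))) ≤
      4 * δ⁻¹ * η * q * d * L ^ 2 * c ^ 2 * (T / m) *
        (1 + 2 ^ (7 / 2 : ℝ) * δ⁻¹ * q * d ^ 2 * c * (L * b + p) * ℓ / g) := by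
  have hS : 0 ≤ T * η * q * L ^ 2 * d * c ^ 2 / (δ * m) := by positivity
  have hX : 0 ≤ q * d / (δ * m * g) := by positivity
  have h1 : d / m ≤ 4 := by rwa [div_le_iff₀ hm]
  -- Width enters here: `d ≤ 4m` absorbs the Lipschitz part of the feature norm, and `hp` the part
  -- from `φ 0`.
  have hk : p + L * (d ^ 2 * (b * ℓ * c)) ≤ 8 * (m * d * c * ((L * b + p) * ℓ)) := by
    have h3 : d * (L * d * (b * ℓ) * c) ≤ 4 * m * (L * d * (b * ℓ) * c) := by gcongr
    have h4 : 0 ≤ m * (L * d * (b * ℓ) * c) := by positivity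
    nlinarith
  -- Only the product `b * ℓ` has a known sign, so nonnegativity is read off from `hk`.
  have hk0 : 0 ≤ m * d * c * ((L * b + p) * ℓ) := by
    have : 0 ≤ p + L * (d ^ 2 * (b * ℓ * c)) := by positivity
    linarith
  have e1 : 1 / m * (L * d * c * (T * (η * (q * ((m * δ)⁻¹ * (L * d * c))))) +
        2 * (q * ((m * δ)⁻¹ * (L * d * c)) * (T * (η * (q * ((m * δ)⁻¹ * (L * d * c)))))) / g *
          (m * (p + L * (d ^ 2 * (b * ℓ * c))))) =
      T * η * q * L ^ 2 * d * c ^ 2 / (δ * m) *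
        (d / m + 2 * (q * d / (δ * m * g) * (p + L * (d ^ 2 * (b * ℓ * c))))) := by
    field_simp
  have e2 : 4 * δ⁻¹ * η * q * d * L ^ 2 * c ^ 2 * (T / m) *
        (1 + 2 ^ (7 / 2 : ℝ) * δ⁻¹ * q * d ^ 2 * c * (L * b + p) * ℓ / g) =
      T * η * q * L ^ 2 * d * c ^ 2 / (δ * m) *
        (4 + 4 * (2 ^ (7 / 2 : ℝ) * (q * d / (δ * m * g) * (m * d * c * ((L * b + p) * ℓ))))) := by
    field_simp
  have h8 : (4 : ℝ) ≤ 2 ^ (7 / 2 : ℝ) := by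
    calc (4 : ℝ) = 2 ^ (2 : ℝ) := by norm_num
      _ ≤ _ := Real.rpow_le_rpow_of_exponent_le (by norm_num) (by norm_num)
  rw [e1, e2]
  refine mul_le_mul_of_nonneg_left (add_le_add h1 ?_) hS
  have h5 := mul_le_mul_of_nonneg_left hk hX
  have h6 := mul_le_mul_of_nonneg_right h8 (mul_nonneg hX hk0)
  linarith

end Assembly

end ContrastivePCA

/-! ### The perturbation bound. -/

open ContrastivePCA in
theorem mainTheorem4
    {D M Z N Q : ℕ} (hZ : 1 ≤ Z) (hZM : Z + 1 ≤ M)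
    -- activation function: Lipschitz and smooth
    (φ : ℝ → ℝ) (Lφ βφ : NNReal) (hφL : LipschitzWith Lφ φ)
    (hφd : Differentiable ℝ φ) (hφβ : LipschitzWith βφ (deriv φ))
    -- constants
    (δ η cin cθ : ℝ) (hδ : 0 < δ) (hη : 0 < η)
    -- signs of the pairs, and the data, bounded in sup norm
    (α : Fin Q → ℝ) (hα : ∀ q, α q = 1 ∨ α q = -1)
    (x : Fin N → Fin D → ℝ) (xp : Fin N → Fin Q → Fin D → ℝ)
    (hx : ∀ n, ‖x n‖ ≤ cin) (hxp : ∀ n q, ‖xp n q‖ ≤ cin)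
    -- training by Grassmannian gradient descent
    (R : Matrix (Fin M) (Fin Z) ℝ → Matrix (Fin M) (Fin Z) ℝ → Matrix (Fin M) (Fin Z) ℝ)
    (hR : IsGrassmannRetraction R)
    (W : ℕ → Matrix (Fin M) (Fin Z) ℝ) (V : ℕ → Matrix (Fin M) (Fin D) ℝ)
    (hrun : IsTrainingRun φ δ η α x xp R W V)
    -- bound on the weights at initialisation
    (hW0 : ∀ i j, |W 0 i j| ≤ cθ * Real.log M)
    (hV0 : ∀ i j, |V 0 i j| ≤ cθ * Real.log M)
    -- the network is wide
    (hwide : D ≤ 16 * M)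
    (hwide0 : φ 0 ≠ 0 → 1 ≤ 8 * cin * Real.sqrt (M * D) * Real.log M)
    -- eigengap at initialisation
    (hgap : contrastEigenvalue φ δ α x xp (V 0) (Z + 1) (Nat.le_add_left 1 Z) hZM
      < contrastEigenvalue φ δ α x xp (V 0) Z hZ (Nat.le_of_succ_le hZM))
    -- number of iterations, and the two PCA solutions
    (t : ℕ) (Wstar Wtilde : Matrix (Fin M) (Fin Z) ℝ)
    (hWstar : IsPCASolution (symContrastMatrix φ δ α x xp (V 0)) Wstar)
    (hWtilde : IsPCASolution (symContrastMatrix φ δ α x xp (V t)) Wtilde) :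
    ∃ O ∈ Matrix.orthogonalGroup (Fin Z) ℝ,
      ∀ y : Fin D → ℝ, ‖y‖ ≤ cin →
        euclNorm (Oᵀ *ᵥ representation φ Wtilde (V t) y - representation φ Wstar (V 0) y) ≤
          zeta D Q δ η Lφ cin * ((t : ℝ) / Real.sqrt M) *
            (1 + xi D Q φ δ Lφ cin cθ * Real.log M /
              (contrastEigenvalue φ δ α x xp (V 0) Z hZ (Nat.le_of_succ_le hZM) -
                contrastEigenvalue φ δ α x xp (V 0) (Z + 1) (Nat.le_add_left 1 Z) hZM)) := by
  have hM : 0 < M := by omega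
  by_cases hcin : 0 ≤ cin
  swap
  -- For negative `cin` no input is admissible.
  · exact ⟨1, one_mem _, fun y hy => absurd ((norm_nonneg y).trans hy) hcin⟩
  obtain ⟨O, hO, hOle⟩ := exists_orthogonal_norm_mul_sub_le hWtilde.1 hWstar.1
  have hdk := gap_mul_norm_proj_sub_proj_le hZ hZM
    (symContrastMatrix_isHermitian φ δ α x xp (V 0)) hgap hWstar hWtilde
  have hVt := hrun.norm_sub_init_le hR hφL hφd hδ hη hM hcin hα hx hxp t
  have hC := norm_symContrastMatrix_sub_le hφL hδ hM hcin hα hx hxp (V t) (V 0)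
  -- The sign is read from an entry of `W 0`, which exists even when `D = 0` and `V 0` is empty.
  have hbℓ : 0 ≤ cθ * Real.log M := (abs_nonneg _).trans (hW0 ⟨0, hM⟩ ⟨0, hZ⟩)
  refine ⟨O, hO, fun y hy => ?_⟩
  have hrep := norm_rotated_representation_sub_le (W := Wstar) φ hWtilde.1
    ((Matrix.mem_orthogonalGroup_iff' (Fin Z) ℝ).1 hO) (V 0) (V t) y
  have hf := norm_feature_sub_le hφL (V t) (V 0) hy
  have hf0 := norm_feature_le hφL hV0 hbℓ hy
  change sortedEigenvalue _ _ < sortedEigenvalue _ _ at hgap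
  have hg := sub_pos.2 hgap
  set g := contrastEigenvalue φ δ α x xp (V 0) Z hZ (Nat.le_of_succ_le hZM) -
    contrastEigenvalue φ δ α x xp (V 0) (Z + 1) (Nat.le_add_left 1 Z) hZM
  have hm : 0 < √(M : ℝ) := by positivity
  have hdm : √(D : ℝ) ≤ 4 * √(M : ℝ) := by
    rw [Real.sqrt_le_left (by positivity), mul_pow, Real.sq_sqrt (by positivity)]
    norm_num
    exact_mod_cast hwide
  have hp : |φ 0| ≤ 8 * cin * (√(M : ℝ) * √(D : ℝ)) * Real.log M * |φ 0| := by
    by_cases h0 : φ 0 = 0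
    · simp [h0]
    · rw [← Real.sqrt_mul (by positivity)]
      exact le_mul_of_one_le_left (abs_nonneg _) (hwide0 h0)
  have hmain := perturbation_constant_le hm (Real.sqrt_nonneg D) hdm hδ hη hcin hbℓ hg
    Lφ.coe_nonneg (Nat.cast_nonneg t) (Nat.cast_nonneg Q) (abs_nonneg (φ 0)) hp
  rw [Real.sq_sqrt (Nat.cast_nonneg D)] at hmain
  have hproj := (le_div_iff₀' hg).2 (hdk.trans (mul_le_mul_of_nonneg_left
    (hC.trans (mul_le_mul_of_nonneg_left hVt (by positivity))) zero_le_two))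
  refine hrep.trans (le_trans ?_ hmain)
  gcongr
  · exact hf.trans (by gcongr)
  · exact hOle.trans hproj
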